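/- Let $K$ be an abstract simplicial complex whose vertices are points of $\mathbb R^2$: a set of non-empty finite subsets of $\mathbb R^2$ (its simplices) that contains every non-empty subset of each of its members; its vertices are the points $v$ with $\{v\}\in K$. Let $|K|$ be its geometric realization (with the weak topology), let $$\mathrm{Sh}(K)=\bigcup_{\sigma\in K}\mathrm{Conv}(\sigma)\subset\mathbb R^2$$ be its shadow (with the subspace topology), and let $p\colon |K|\to \mathrm{Sh}(K)$ be the shadow projection, i.e. the linear extension of the inclusion of the vertices into $\mathbb R^2$; in barycentric coordinates $p\left(\sum_v t_v v\right)=\sum_v t_v v\in\mathbb R^2$. For vertices $v_0,\dots,v_k$, possibly with repetitions, write $[v_0\cdots v_k]$ for the set $\{v_0,\dots,v_k\}$. Assume that $|K|$ is connected and that the shadow is a locally finite union: every point of $\mathrm{Sh}(K)$ has a neighbourhood in $\mathbb R^2$ that meets $\mathrm{Conv}(\sigma)$ for only finitely many simplices $\sigma$ of $K$ (this is automatic if $K$ is finite). Assume that $K$ satisfies the lifting condition: whenever the images $\mathrm{Conv}(e)$ and $\mathrm{Conv}(f)$ of two edges $e,f$ of $K$ intersect, one of the two edges can be written as $[AB]$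 and the other as $[CD]$ so that there exist vertices $E,F$ of $K$ for which (A) $[ABE]$ and $[CDE]$ are simplices of $K$, or (B) $[AEF]$ and $[CDEF]$ are simplices of $K$, and the segment $EF$ intersects the segment $AB$. Then $p$ induces an epimorphism on fundamental groups: for every base point $x\in|K|$ the homomorphism $p_*\colon\pi_1(|K|,x)\to\pi_1(\mathrm{Sh}(K),p(x))$ is surjective. -/

import Mathlib

open Topology

namespace PreAbstractSimplicialComplex

section Realization

variable {V : Type*}

/-- The geometric realization `|K|` of an abstract simplicial complex `K`, as a set: finitely
supported families of barycentric coordinates whose support is a simplex of `K`. -/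
def Realization (K : PreAbstractSimplicialComplex V) : Type _ :=
  {w : V →₀ ℝ // w.support ∈ K.faces ∧ (∀ v, 0 ≤ w v) ∧ (w.sum fun _ t => t) = 1}

/-- The inclusion into `|K|` of the closed standard simplex spanned by a simplex `σ` of `K`:
barycentric coordinates on `σ` are extended by zero. -/
noncomputable def simplexInclusion (K : PreAbstractSimplicialComplex V) (σ : K.faces)
    (w : stdSimplex ℝ (σ : Finset V)) : K.Realization :=
  ⟨(Finsupp.equivFunOnFinite.symm w.1).embDomain
      (Function.Embedding.subtype _), by
    have hsum : ((Finsupp.equivFunOnFinite.symm w.1).embDomain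
        (Function.Embedding.subtype (· ∈ (σ : Finset V)))).sum (fun _ t => t) = 1 := by
      rw [Finsupp.sum_embDomain, Finsupp.sum_fintype _ _ (fun _ => rfl)]
      exact w.2.2
    refine ⟨(K.isRelLowerSet_faces σ.2).2 ?_ ?_, ?_, hsum⟩
    · intro v hv
      rw [Finsupp.support_embDomain, Finset.mem_map] at hv
      obtain ⟨u, _, rfl⟩ := hv
      exact u.2
    · rw [Finset.nonempty_iff_ne_empty]
      intro h
      rw [Finsupp.support_eq_empty] at h
      rw [h, Finsupp.sum_zero_index] at hsum
      exact zero_ne_one hsum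
    · intro v
      by_cases hv : v ∈ (σ : Finset V)
      · have := Finsupp.embDomain_apply_self (Function.Embedding.subtype (· ∈ (σ : Finset V)))
          (Finsupp.equivFunOnFinite.symm w.1) ⟨v, hv⟩
        simp only [Function.Embedding.subtype_apply] at this
        rw [this]
        exact w.2.1 ⟨v, hv⟩
      · rw [Finsupp.embDomain_of_notMem_range]
        rintro ⟨u, rfl⟩
        exact hv u.2⟩

/-- The weak (coherent) topology on `|K|`: the finest topology for which the inclusions of all
closed simplices are continuous. -/
noncomputable instance (K : PreAbstractSimplicialComplex V) : TopologicalSpace K.Realization :=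
  ⨆ σ : K.faces, TopologicalSpace.coinduced (K.simplexInclusion σ) inferInstance

end Realization

section Shadow

variable {N : ℕ}

/-- The shadow of an abstract simplicial complex with vertices in `ℝ^N`: the union of the convex
hulls of its simplices, a subset of `ℝ^N`. -/
def shadow (K : PreAbstractSimplicialComplex (EuclideanSpace ℝ (Fin N))) :
    Set (EuclideanSpace ℝ (Fin N)) :=
  ⋃ σ ∈ K.faces, convexHull ℝ (σ : Set (EuclideanSpace ℝ (Fin N)))

/-- The linear extension to `|K|` of the inclusion of the vertices of `K` into `ℝ^N`. -/
noncomputable def linearProjection (K : PreAbstractSimplicialComplex (EuclideanSpace ℝ (Fin N)))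
    (w : K.Realization) : EuclideanSpace ℝ (Fin N) :=
  w.1.sum fun v t => t • v

theorem linearProjection_mem_shadow (K : PreAbstractSimplicialComplex (EuclideanSpace ℝ (Fin N)))
    (w : K.Realization) : K.linearProjection w ∈ K.shadow := by
  refine Set.mem_biUnion w.2.1 ?_
  exact (convex_convexHull ℝ _).sum_mem (fun v _ => w.2.2.1 v) w.2.2.2
    (fun v hv => subset_convexHull ℝ _ hv)

theorem continuous_linearProjection
    (K : PreAbstractSimplicialComplex (EuclideanSpace ℝ (Fin N))) :
    Continuous K.linearProjection := by
  refine continuous_iSup_dom.2 fun σ => continuous_coinduced_dom.2 ?_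
  have h : K.linearProjection ∘ K.simplexInclusion σ =
      fun w : stdSimplex ℝ (σ : Finset (EuclideanSpace ℝ (Fin N))) =>
        ∑ v, w.1 v • (v : EuclideanSpace ℝ (Fin N)) := by
    funext w
    simp only [Function.comp_apply, linearProjection, simplexInclusion]
    rw [Finsupp.sum_embDomain]
    exact Finsupp.sum_fintype _ _ (fun _ => zero_smul _ _)
  rw [h]
  exact continuous_finsetSum _ fun v _ =>
    ((continuous_apply v).comp continuous_subtype_val).smul continuous_const

/-- The shadow projection `p : |K| → Sh(K)`. -/
noncomputable def shadowProjection
    (K : PreAbstractSimplicialComplex (EuclideanSpace ℝ (Fin N))) : C(K.Realization, K.shadow) where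
  toFun w := ⟨K.linearProjection w, K.linearProjection_mem_shadow w⟩
  continuous_toFun := K.continuous_linearProjection.subtype_mk _

/-- Every point of the shadow has a neighbourhood that meets the convex hulls of only finitely
many simplices of `K`. -/
def ShadowLocallyFinite (K : PreAbstractSimplicialComplex (EuclideanSpace ℝ (Fin N))) : Prop :=
  ∀ x ∈ K.shadow, ∃ U ∈ 𝓝 x,
    {σ ∈ K.faces | (convexHull ℝ (σ : Set (EuclideanSpace ℝ (Fin N))) ∩ U).Nonempty}.Finite

open Classical in
/-- The shadow path lifting condition: whenever the images of two edges of `K` intersect, the two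
edges can be written as `[AB]` and `[CD]` in such a way that (A) or (B) holds for some vertices
`E`, `F` of `K`. The vertices `A, B, C, D, E, F` need not be distinct, and a list of vertices with
repetitions denotes the simplex on the underlying set. -/
def LiftingCondition (K : PreAbstractSimplicialComplex (EuclideanSpace ℝ (Fin 2))) : Prop :=
  ∀ e ∈ K.faces, ∀ f ∈ K.faces, e.card = 2 → f.card = 2 →
    (convexHull ℝ (e : Set (EuclideanSpace ℝ (Fin 2))) ∩
      convexHull ℝ (f : Set (EuclideanSpace ℝ (Fin 2)))).Nonempty →
    ∃ A B C D : EuclideanSpace ℝ (Fin 2),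
      ((e = {A, B} ∧ f = {C, D}) ∨ (e = {C, D} ∧ f = {A, B})) ∧
      ∃ E F : EuclideanSpace ℝ (Fin 2), {E} ∈ K.faces ∧ {F} ∈ K.faces ∧
        (({A, B, E} ∈ K.faces ∧ {C, D, E} ∈ K.faces) ∨
          ({A, E, F} ∈ K.faces ∧ {C, D, E, F} ∈ K.faces ∧
            (segment ℝ E F ∩ segment ℝ A B).Nonempty))

end Shadow

end PreAbstractSimplicialComplex

/-! The heart is a statement about fibres (`LiftingCondition.liftsIn_singleton`): two points of
`|K|` with the same image are joined by a path whose projection is null-homotopic. Given this, a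
path in the shadow is lifted up to homotopy piece by piece, and mismatched lifts at the joints cost
nothing. Local finiteness gives every point `y` a ball that is met only by hulls containing `y`; the
shadow is star-shaped about `y` there, so a short path may be replaced by one through `y`, made of
segments inside simplices.

For the fibres, let the hulls of two simplices share a point. In the plane, either a chord (a
vertex, or a segment between two vertices) of one meets a chord of the other, or one hull contains
the vertices of the other simplex. In the first case the lifting condition connects the lifts of the
crossing point. In the second, connectedness of `|K|` supplies an edge path from the inner simplex
to the outer one, and where it first leaves the outer hull it crosses a chord, so the first case
applies.

Homotopies come from star-shaped subsets of the shadow, which are simply connected. `LiftsIn`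
therefore records a set in which the projection runs up to homotopy; a union of hulls with a common
point is star-shaped, and inside it the projection can be straightened. -/

/-- Two paths with the same endpoints in a subspace `X` of a real topological vector space that
run in a star-shaped subset of `X` are homotopic in `X`. -/
theorem StarConvex.path_homotopic {E : Type*} [AddCommGroup E] [Module ℝ E] [TopologicalSpace E]
    [ContinuousAdd E] [ContinuousSMul ℝ E] {X S : Set E} {c : E} (hS : StarConvex ℝ c S)
    (hSX : S ⊆ X) {a b : X} (p q : Path a b) (hp : ∀ t, (p t : E) ∈ S)
    (hq : ∀ t, (q t : E) ∈ S) : p.Homotopic q := by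
  have ha : (a : E) ∈ S := by simpa using hp 0
  have hb : (b : E) ∈ S := by simpa using hp 1
  have : ContractibleSpace S := hS.contractibleSpace ⟨_, ha⟩
  let lift : ∀ r : Path a b, (∀ t, (r t : E) ∈ S) →
      Path (⟨a, ha⟩ : S) (⟨b, hb⟩ : S) := fun r hr =>
    { toFun := fun t => ⟨r t, hr t⟩
      continuous_toFun := (continuous_subtype_val.comp r.continuous).subtype_mk _
      source' := by simp
      target' := by simp }
  have h := (SimplyConnectedSpace.paths_homotopic (lift p hp) (lift q hq)).map
    (⟨Set.inclusion hSX, continuous_inclusion hSX⟩ : C(S, X))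
  exact h

/-! ### Closed simplices and lifts of points of their hulls -/

namespace PreAbstractSimplicialComplex

variable {N : ℕ} {K : PreAbstractSimplicialComplex (EuclideanSpace ℝ (Fin N))}

theorem convexHull_subset_shadow {σ : Finset (EuclideanSpace ℝ (Fin N))} (hσ : σ ∈ K.faces) :
    convexHull ℝ (σ : Set (EuclideanSpace ℝ (Fin N))) ⊆ K.shadow :=
  fun _ hx => Set.mem_biUnion hσ hx

theorem linearProjection_mem_convexHull {σ : Finset (EuclideanSpace ℝ (Fin N))}
    {w : K.Realization} (hw : w.1.support ⊆ σ) :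
    K.linearProjection w ∈ convexHull ℝ (σ : Set (EuclideanSpace ℝ (Fin N))) :=
  (convex_convexHull ℝ _).sum_mem (fun v _ => w.2.2.1 v) w.2.2.2
    (fun _ hv => subset_convexHull ℝ _ (hw hv))

theorem support_simplexInclusion_subset {V : Type*} (L : PreAbstractSimplicialComplex V)
    (σ : L.faces) (a : stdSimplex ℝ (σ : Finset V)) :
    (L.simplexInclusion σ a).1.support ⊆ σ := by
  intro v hv
  simp only [simplexInclusion, Finsupp.support_embDomain, Finset.mem_map] at hv
  obtain ⟨u, _, rfl⟩ := hv
  exact u.2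

theorem continuous_simplexInclusion {V : Type*} (L : PreAbstractSimplicialComplex V)
    (σ : L.faces) : Continuous (L.simplexInclusion σ) :=
  continuous_iSup_rng (i := σ) continuous_coinduced_rng

theorem simplexInclusion_apply {V : Type*} (L : PreAbstractSimplicialComplex V)
    (σ : L.faces) (a : stdSimplex ℝ (σ : Finset V)) (v : (σ : Finset V)) :
    (L.simplexInclusion σ a).1 v = a.1 v := by
  have := Finsupp.embDomain_apply_self (Function.Embedding.subtype (· ∈ (σ : Finset V)))
    (Finsupp.equivFunOnFinite.symm a.1) v
  simpa [simplexInclusion] using this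

theorem exists_simplexInclusion_eq {V : Type*} (L : PreAbstractSimplicialComplex V)
    (σ : L.faces) {w : L.Realization} (hw : w.1.support ⊆ σ) :
    ∃ a, L.simplexInclusion σ a = w := by
  refine ⟨⟨fun v => w.1 v, fun v => w.2.2.1 v, ?_⟩, ?_⟩
  · have h := w.2.2.2
    rw [Finsupp.sum_of_support_subset _ hw _ (fun _ _ => rfl)] at h
    exact (Finset.sum_coe_sort (σ : Finset V) (fun v => w.1 v)).trans h
  · apply Subtype.ext
    ext v
    by_cases hv : v ∈ (σ : Finset V)
    · exact L.simplexInclusion_apply σ _ ⟨v, hv⟩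
    · rw [Finsupp.notMem_support_iff.1 fun h => hv (hw h),
        Finsupp.notMem_support_iff.1 fun h => hv (L.support_simplexInclusion_subset σ _ h)]

theorem exists_lift {σ : Finset (EuclideanSpace ℝ (Fin N))} (hσ : σ ∈ K.faces)
    {y : EuclideanSpace ℝ (Fin N)}
    (hy : y ∈ convexHull ℝ (σ : Set (EuclideanSpace ℝ (Fin N)))) :
    ∃ w : K.Realization, w.1.support ⊆ σ ∧ K.linearProjection w = y := by
  obtain ⟨f, hf0, hf1, hfy⟩ := Finset.mem_convexHull'.1 hy
  have hmem : (fun v : (σ : Finset (EuclideanSpace ℝ (Fin N))) => f v) ∈ stdSimplex ℝ _ :=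
    ⟨fun v => hf0 v v.2, by rw [← hf1]; exact Finset.sum_coe_sort σ f⟩
  have hs := K.support_simplexInclusion_subset ⟨σ, hσ⟩ ⟨_, hmem⟩
  refine ⟨K.simplexInclusion ⟨σ, hσ⟩ ⟨_, hmem⟩, hs, ?_⟩
  refine (Finsupp.sum_of_support_subset _ hs (fun v t => t • v)
    (fun v _ => zero_smul ℝ v)).trans ?_
  rw [← hfy]
  refine Finset.sum_congr rfl fun v hv => ?_
  rw [K.simplexInclusion_apply ⟨σ, hσ⟩ ⟨_, hmem⟩ ⟨v, hv⟩]

/-! ### Paths in the realization, up to homotopy of their projections -/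

/-- Some path in `|K|` from `w₁` to `w₂` projects to a path of the shadow that is homotopic to
one running in `S`. -/
def LiftsIn (K : PreAbstractSimplicialComplex (EuclideanSpace ℝ (Fin N)))
    (S : Set (EuclideanSpace ℝ (Fin N))) (w₁ w₂ : K.Realization) : Prop :=
  ∃ (δ : Path w₁ w₂) (ε : Path (K.shadowProjection w₁) (K.shadowProjection w₂)),
    (∀ t, (ε t : EuclideanSpace ℝ (Fin N)) ∈ S) ∧
      (δ.map K.shadowProjection.continuous).Homotopic ε

namespace LiftsIn

variable {S T : Set (EuclideanSpace ℝ (Fin N))} {w₁ w₂ w₃ : K.Realization}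

theorem mono (h : K.LiftsIn S w₁ w₂) (hST : S ⊆ T) : K.LiftsIn T w₁ w₂ := by
  obtain ⟨δ, ε, hε, h⟩ := h
  exact ⟨δ, ε, fun t => hST (hε t), h⟩

theorem symm (h : K.LiftsIn S w₁ w₂) : K.LiftsIn S w₂ w₁ := by
  obtain ⟨δ, ε, hε, h⟩ := h
  refine ⟨δ.symm, ε.symm, fun t => hε _, ?_⟩
  simpa using h.symm₂

theorem trans (h : K.LiftsIn S w₁ w₂) (h' : K.LiftsIn S w₂ w₃) : K.LiftsIn S w₁ w₃ := by
  obtain ⟨δ, ε, hε, h⟩ := h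
  obtain ⟨δ', ε', hε', h'⟩ := h'
  refine ⟨δ.trans δ', ε.trans ε', fun t => ?_, ?_⟩
  · rw [Path.trans_apply]
    split_ifs
    exacts [hε _, hε' _]
  · rw [Path.map_trans]
    exact h.hcomp h'

theorem of_support_subset {σ : Finset (EuclideanSpace ℝ (Fin N))} (hσ : σ ∈ K.faces)
    (h₁ : w₁.1.support ⊆ σ) (h₂ : w₂.1.support ⊆ σ) :
    K.LiftsIn (convexHull ℝ (σ : Set (EuclideanSpace ℝ (Fin N)))) w₁ w₂ := by
  obtain ⟨a, rfl⟩ := K.exists_simplexInclusion_eq ⟨σ, hσ⟩ h₁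
  obtain ⟨b, rfl⟩ := K.exists_simplexInclusion_eq ⟨σ, hσ⟩ h₂
  obtain ⟨r⟩ : Joined a b := by
    have := (convex_stdSimplex ℝ σ).isPathConnected ⟨a.1, a.2⟩
    exact (joinedIn_iff_joined a.2 b.2).1 (this.joinedIn _ a.2 _ b.2)
  refine ⟨r.map (K.continuous_simplexInclusion ⟨σ, hσ⟩), _, fun t => ?_, Path.Homotopic.refl _⟩
  exact linearProjection_mem_convexHull (K.support_simplexInclusion_subset ⟨σ, hσ⟩ _)

/-- Inside a star-shaped part of the shadow the projected path can be straightened. -/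
theorem segment (h : K.LiftsIn S w₁ w₂) {c : EuclideanSpace ℝ (Fin N)} (hS : StarConvex ℝ c S)
    (hSK : S ⊆ K.shadow)
    (hseg : _root_.segment ℝ (K.linearProjection w₁) (K.linearProjection w₂) ⊆ S) :
    K.LiftsIn (_root_.segment ℝ (K.linearProjection w₁) (K.linearProjection w₂)) w₁ w₂ := by
  obtain ⟨δ, ε, hε, h⟩ := h
  have hmem : ∀ t : unitInterval, AffineMap.lineMap (K.linearProjection w₁)
      (K.linearProjection w₂) (t : ℝ) ∈
      _root_.segment ℝ (K.linearProjection w₁) (K.linearProjection w₂) := fun t => by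
    rw [segment_eq_image_lineMap]
    exact ⟨t, t.2, rfl⟩
  let ε' : Path (K.shadowProjection w₁) (K.shadowProjection w₂) :=
    { toFun := fun t => ⟨AffineMap.lineMap (K.linearProjection w₁)
        (K.linearProjection w₂) (t : ℝ), hSK (hseg (hmem t))⟩
      continuous_toFun := by
        refine Continuous.subtype_mk ?_ _
        exact AffineMap.lineMap_continuous.comp continuous_subtype_val
      source' := Subtype.ext (by simp [shadowProjection])
      target' := Subtype.ext (by simp [shadowProjection]) }
  exact ⟨δ, ε', hmem, h.trans (hS.path_homotopic hSK ε ε' hε fun t => hseg (hmem t))⟩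

/-- With equal images at both ends the straightened projection is constant. This turns a detour
through a star-shaped set into a statement about one fibre. -/
theorem singleton (h : K.LiftsIn S w₁ w₂) {c : EuclideanSpace ℝ (Fin N)} (hS : StarConvex ℝ c S)
    (hSK : S ⊆ K.shadow) (heq : K.linearProjection w₁ = K.linearProjection w₂)
    (hw : K.linearProjection w₁ ∈ S) : K.LiftsIn {K.linearProjection w₁} w₁ w₂ := by
  have := h.segment hS hSK (by rw [← heq, segment_same]; simpa using hw)
  rwa [← heq, segment_same] at this

theorem segment_of_support_subset {σ : Finset (EuclideanSpace ℝ (Fin N))} (hσ : σ ∈ K.faces)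
    (h₁ : w₁.1.support ⊆ σ) (h₂ : w₂.1.support ⊆ σ) :
    K.LiftsIn (_root_.segment ℝ (K.linearProjection w₁) (K.linearProjection w₂)) w₁ w₂ :=
  (of_support_subset hσ h₁ h₂).segment
    ((convex_convexHull ℝ _).starConvex (linearProjection_mem_convexHull h₁))
    (convexHull_subset_shadow hσ)
    ((convex_convexHull ℝ _).segment_subset (linearProjection_mem_convexHull h₁)
      (linearProjection_mem_convexHull h₂))

end LiftsIn

/-! ### Edge paths in a connected complex -/

/-- Vertices joined by an edge, or equal. -/
def Joins {V : Type*} (L : PreAbstractSimplicialComplex V) (v v' : V) : Prop :=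
  ∃ σ ∈ L.faces, v ∈ σ ∧ v' ∈ σ

theorem mem_faces_of_subset {V : Type*} {L : PreAbstractSimplicialComplex V} {σ τ : Finset V}
    (hσ : σ ∈ L.faces) (h : τ ⊆ σ) (hτ : τ.Nonempty) : τ ∈ L.faces :=
  (L.isRelLowerSet_faces hσ).2 h hτ

theorem nonempty_of_mem_faces {V : Type*} {L : PreAbstractSimplicialComplex V} {σ : Finset V}
    (hσ : σ ∈ L.faces) : σ.Nonempty :=
  (L.isRelLowerSet_faces hσ).1

/-- In a connected complex any two vertices are joined by an edge path. -/
theorem reflTransGen_joins {V : Type*} {L : PreAbstractSimplicialComplex V}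
    [ConnectedSpace L.Realization] {σ τ : Finset V} (hσ : σ ∈ L.faces) (hτ : τ ∈ L.faces)
    {v u : V} (hv : v ∈ σ) (hu : u ∈ τ) : Relation.ReflTransGen L.Joins v u := by
  classical
  have hvert : ∀ {ρ : Finset V} (hρ : ρ ∈ L.faces) {x : V}, x ∈ ρ →
      ∃ w : L.Realization, w.1.support = {x} := by
    intro ρ hρ x hx
    have h1 : ((Finsupp.single x (1 : ℝ))).support = {x} :=
      Finsupp.support_single _ one_ne_zero
    refine ⟨⟨Finsupp.single x 1, ?_, ?_, by simp⟩, h1⟩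
    · rw [h1]
      exact mem_faces_of_subset hρ (by simpa using hx) (Finset.singleton_nonempty x)
    · intro y
      rw [Finsupp.single_apply]
      split_ifs <;> norm_num
  let A : Set L.Realization := {w | ∃ x ∈ w.1.support, Relation.ReflTransGen L.Joins v x}
  -- Within one closed simplex all vertices are mutually joined, so `A` contains all of it or none;
  -- in the weak topology this makes `A` clopen.
  have key : ∀ ρ : L.faces, (L.simplexInclusion ρ ⁻¹' A) = Set.univ ∨
      (L.simplexInclusion ρ ⁻¹' A) = ∅ := by
    intro ρ
    rcases Set.eq_empty_or_nonempty (L.simplexInclusion ρ ⁻¹' A) with h | ⟨a, x, hx, hvx⟩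
    · exact Or.inr h
    · refine Or.inl (Set.eq_univ_of_forall fun b => ?_)
      obtain ⟨y, hy⟩ := nonempty_of_mem_faces (L.simplexInclusion ρ b).2.1
      exact ⟨y, hy, hvx.tail ⟨ρ, ρ.2, L.support_simplexInclusion_subset ρ _ hx,
        L.support_simplexInclusion_subset ρ _ hy⟩⟩
  have hA : IsClopen A := by
    constructor
    · refine isClosed_iSup_iff.2 fun ρ => isClosed_coinduced.2 ?_
      rcases key ρ with h | h <;> rw [h] <;> simp
    · refine isOpen_iSup_iff.2 fun ρ => isOpen_coinduced.2 ?_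
      rcases key ρ with h | h <;> rw [h] <;> simp
  obtain ⟨wv, hwv⟩ := hvert hσ hv
  obtain ⟨wu, hwu⟩ := hvert hτ hu
  have hmem : wu ∈ A := by
    rw [hA.eq_univ ⟨wv, v, by simp [hwv], Relation.ReflTransGen.refl⟩]
    trivial
  obtain ⟨x, hx, hvx⟩ := hmem
  rw [hwu, Finset.mem_singleton] at hx
  exact hx ▸ hvx

end PreAbstractSimplicialComplex

/-! ### Convex polygons in the plane -/

/-- A point of a convex polygon is an interior point or lies on a segment between vertices. -/
theorem mem_interior_convexHull_or_exists_card_le_two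
    {σ : Finset (EuclideanSpace ℝ (Fin 2))} {z : EuclideanSpace ℝ (Fin 2)}
    (hz : z ∈ convexHull ℝ (σ : Set (EuclideanSpace ℝ (Fin 2)))) :
    z ∈ interior (convexHull ℝ (σ : Set (EuclideanSpace ℝ (Fin 2)))) ∨
      ∃ e ⊆ σ, e.Nonempty ∧ e.card ≤ 2 ∧
        z ∈ convexHull ℝ (e : Set (EuclideanSpace ℝ (Fin 2))) := by
  classical
  obtain ⟨ι, _, f, w, hf, hind, hw, hw1, hwz⟩ := eq_pos_convex_span_of_mem_convexHull hz
  -- Carathéodory: the independent points number at most three. With three, they form an affine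
  -- basis, and positivity of the weights puts `z` in the interior of the triangle.
  have hcard : Fintype.card ι ≤ 3 := by
    simpa using hind.card_le_finrank_succ.trans
      (Nat.succ_le_succ (Submodule.finrank_le (vectorSpan ℝ (Set.range f))))
  have hne : (Finset.univ : Finset ι).Nonempty := by
    rw [Finset.nonempty_iff_ne_empty]
    intro h
    rw [h, Finset.sum_empty] at hw1
    exact zero_ne_one hw1
  rcases hcard.lt_or_eq with h | h
  · refine Or.inr ⟨Finset.univ.image f, ?_, hne.image f,
      Finset.card_image_le.trans (Nat.lt_succ_iff.1 h), ?_⟩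
    · intro x hx
      obtain ⟨i, _, rfl⟩ := Finset.mem_image.1 hx
      exact hf ⟨i, rfl⟩
    · rw [← hwz]
      refine (convex_convexHull ℝ _).sum_mem (fun i _ => (hw i).le) hw1 fun i _ => ?_
      exact subset_convexHull ℝ _ (by simp)
  · left
    have htop : affineSpan ℝ (Set.range f) = ⊤ :=
      hind.affineSpan_eq_top_iff_card_eq_finrank_add_one.2 (by simp [h])
    let b : AffineBasis ι ℝ (EuclideanSpace ℝ (Fin 2)) := ⟨f, hind, htop⟩
    refine interior_mono (convexHull_mono hf) ?_
    change z ∈ interior (convexHull ℝ (Set.range b))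
    rw [b.interior_convexHull]
    intro i
    have hz' : z = Finset.univ.affineCombination ℝ b w := by
      rw [Finset.affineCombination_eq_linear_combination _ _ _ hw1]
      exact hwz.symm
    rw [hz', b.coord_apply_combination_of_mem (Finset.mem_univ i) hw1]
    exact hw i

/-- A segment leaving a convex polygon meets a segment between two of its vertices. -/
theorem exists_card_le_two_inter_segment_nonempty
    {σ : Finset (EuclideanSpace ℝ (Fin 2))} {x y : EuclideanSpace ℝ (Fin 2)}
    (hx : x ∈ convexHull ℝ (σ : Set (EuclideanSpace ℝ (Fin 2))))
    (hy : y ∉ convexHull ℝ (σ : Set (EuclideanSpace ℝ (Fin 2)))) :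
    ∃ e ⊆ σ, e.Nonempty ∧ e.card ≤ 2 ∧
      (convexHull ℝ (e : Set (EuclideanSpace ℝ (Fin 2))) ∩ segment ℝ x y).Nonempty := by
  have hcl : IsClosed (convexHull ℝ (σ : Set (EuclideanSpace ℝ (Fin 2)))) :=
    σ.finite_toSet.isClosed_convexHull ℝ
  -- Otherwise the interior and the complement of the hull would disconnect the segment.
  obtain ⟨z, hz, hzf⟩ : ∃ z ∈ segment ℝ x y,
      z ∈ convexHull ℝ (σ : Set (EuclideanSpace ℝ (Fin 2))) \ interior (convexHull ℝ σ) := by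
    by_contra! hcon
    have hint : ∀ z ∈ segment ℝ x y, z ∈ convexHull ℝ (σ : Set (EuclideanSpace ℝ (Fin 2))) →
        z ∈ interior (convexHull ℝ (σ : Set (EuclideanSpace ℝ (Fin 2)))) :=
      fun z hz hzσ => not_not.1 fun h => hcon z hz ⟨hzσ, h⟩
    obtain ⟨z, -, hz, hz'⟩ := (convex_segment x y).isPreconnected _ _ isOpen_interior
      hcl.isOpen_compl (fun z hz => (em _).imp (hint z hz) id)
      ⟨x, left_mem_segment ℝ x y, hint x (left_mem_segment ℝ x y) hx⟩
      ⟨y, right_mem_segment ℝ x y, hy⟩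
    exact hz' (interior_subset hz)
  obtain ⟨e, he, hne, hc, hze⟩ :=
    (mem_interior_convexHull_or_exists_card_le_two hzf.1).resolve_left hzf.2
  exact ⟨e, he, hne, hc, z, hze, hz⟩

/-- Of two convex polygons that meet, one contains the other, or a vertex or edge of one meets a
vertex or edge of the other. -/
theorem convexHull_inter_trichotomy {σ τ : Finset (EuclideanSpace ℝ (Fin 2))}
    {y : EuclideanSpace ℝ (Fin 2)}
    (hσ : y ∈ convexHull ℝ (σ : Set (EuclideanSpace ℝ (Fin 2))))
    (hτ : y ∈ convexHull ℝ (τ : Set (EuclideanSpace ℝ (Fin 2)))) :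
    (τ : Set (EuclideanSpace ℝ (Fin 2))) ⊆ convexHull ℝ (σ : Set (EuclideanSpace ℝ (Fin 2))) ∨
    (σ : Set (EuclideanSpace ℝ (Fin 2))) ⊆ convexHull ℝ (τ : Set (EuclideanSpace ℝ (Fin 2))) ∨
    ∃ e ⊆ σ, e.Nonempty ∧ e.card ≤ 2 ∧ ∃ f ⊆ τ, f.Nonempty ∧ f.card ≤ 2 ∧
      (convexHull ℝ (e : Set (EuclideanSpace ℝ (Fin 2))) ∩
        convexHull ℝ (f : Set (EuclideanSpace ℝ (Fin 2)))).Nonempty := by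
  classical
  by_contra! hcon
  obtain ⟨h1, h2, h3⟩ := hcon
  obtain ⟨v, hv, hvσ⟩ := Set.not_subset.1 h1
  obtain ⟨u, hu, huτ⟩ := Set.not_subset.1 h2
  -- an edge of `σ` that leaves the hull of `τ` meets an edge of `τ`
  have cross : ∀ e ⊆ σ, e.Nonempty → e.card ≤ 2 →
      ∀ p ∈ convexHull ℝ (e : Set (EuclideanSpace ℝ (Fin 2))),
      p ∈ convexHull ℝ (τ : Set (EuclideanSpace ℝ (Fin 2))) →
      ∀ q ∈ convexHull ℝ (e : Set (EuclideanSpace ℝ (Fin 2))),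
      q ∈ convexHull ℝ (τ : Set (EuclideanSpace ℝ (Fin 2))) := by
    intro e he hne hc p hp hpτ q hq
    by_contra hqτ
    obtain ⟨f, hf, hfne, hfc, z, hz, hz'⟩ := exists_card_le_two_inter_segment_nonempty hpτ hqτ
    have : z ∈ (∅ : Set (EuclideanSpace ℝ (Fin 2))) := by
      rw [← h3 e he hne hc f hf hfne hfc]
      exact ⟨(convex_convexHull ℝ _).segment_subset hp hq hz', hz⟩
    exact this
  -- The segment from `y` to `v` leaves the hull of `σ` through a chord `e` at a point `z` of the
  -- hull of `τ`. By `cross`, the end `a` of `e` lies in that hull, and then so does `u`, along the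
  -- chord `{a, u}`: a contradiction.
  obtain ⟨e, he, hne, hc, z, hz, hz'⟩ := exists_card_le_two_inter_segment_nonempty hσ hvσ
  have hzτ := (convex_convexHull ℝ _).segment_subset hτ (subset_convexHull ℝ _ hv) hz'
  obtain ⟨a, ha⟩ := hne
  have haτ := cross e he ⟨a, ha⟩ hc z hz hzτ a (subset_convexHull ℝ _ ha)
  refine huτ (cross {a, u} ?_ (by simp) Finset.card_le_two a
    (subset_convexHull ℝ _ (by simp)) haτ u (subset_convexHull ℝ _ (by simp)))
  intro x hx
  rcases Finset.mem_insert.1 hx with rfl | hx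
  · exact he ha
  · rw [Finset.mem_singleton.1 hx]
    exact hu

/-! ### Comparing lifts in a fibre -/

namespace PreAbstractSimplicialComplex

variable {K : PreAbstractSimplicialComplex (EuclideanSpace ℝ (Fin 2))}

/-- A face with at most two vertices of a connected complex lies in an edge, unless it is the
only face. -/
theorem exists_edge_superset_or_eq {V : Type*} {L : PreAbstractSimplicialComplex V}
    [ConnectedSpace L.Realization] {e f : Finset V} (he : e ∈ L.faces) (hf : f ∈ L.faces)
    (hc : e.card ≤ 2) : (∃ e' ∈ L.faces, e'.card = 2 ∧ e ⊆ e') ∨ f = e := by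
  classical
  rcases hc.lt_or_eq with h | h
  swap
  · exact Or.inl ⟨e, he, h, subset_rfl⟩
  obtain ⟨v, rfl⟩ : ∃ v, e = {v} :=
    Finset.card_eq_one.1 (by have := (nonempty_of_mem_faces he).card_pos; omega)
  by_cases hv : ∃ v', v' ≠ v ∧ L.Joins v v'
  · obtain ⟨v', hne, σ, hσ, h1, h2⟩ := hv
    exact Or.inl ⟨{v, v'}, mem_faces_of_subset hσ (by simp [Finset.insert_subset_iff, h1, h2])
      (by simp), Finset.card_pair hne.symm, by simp⟩
  · right
    push Not at hv
    have hall : ∀ u ∈ f, u = v := by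
      intro u hu
      have := reflTransGen_joins he hf (Finset.mem_singleton_self v) hu
      clear hu
      induction this with
      | refl => rfl
      | tail _ h ih => exact by_contra fun hne => hv _ hne (ih ▸ h)
    exact Finset.eq_singleton_iff_nonempty_unique_mem.2 ⟨nonempty_of_mem_faces hf, hall⟩

theorem exists_vertex_lift {σ : Finset (EuclideanSpace ℝ (Fin 2))} (hσ : σ ∈ K.faces)
    {v : EuclideanSpace ℝ (Fin 2)} (hv : v ∈ σ) :
    ∃ w : K.Realization, w.1.support = {v} := by
  have hface : {v} ∈ K.faces :=
    mem_faces_of_subset hσ (by simpa using hv) (Finset.singleton_nonempty v)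
  obtain ⟨w, hw, -⟩ := K.exists_lift hface (y := v) (subset_convexHull ℝ _ (by simp))
  refine ⟨w, (Finset.Nonempty.subset_singleton_iff ?_).1 hw⟩
  exact nonempty_of_mem_faces w.2.1

open Classical in
/-- The situations (A) and (B) of the lifting condition provide a path between two lifts of a
common point of the edges `AB` and `CD`. -/
theorem liftsIn_singleton_of_faces {A B C D E F : EuclideanSpace ℝ (Fin 2)}
    (hAB : {A, B} ∈ K.faces)
    (h : ({A, B, E} ∈ K.faces ∧ {C, D, E} ∈ K.faces) ∨
      ({A, E, F} ∈ K.faces ∧ {C, D, E, F} ∈ K.faces ∧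
        (segment ℝ E F ∩ segment ℝ A B).Nonempty))
    {w₁ w₂ : K.Realization} (h₁ : w₁.1.support ⊆ {A, B}) (h₂ : w₂.1.support ⊆ {C, D})
    (heq : K.linearProjection w₁ = K.linearProjection w₂) :
    K.LiftsIn {K.linearProjection w₁} w₁ w₂ := by
  rcases h with ⟨hABE, hCDE⟩ | ⟨hAEF, hCDEF, z, hzE, hzA⟩
  · obtain ⟨wE, hE⟩ := exists_vertex_lift hABE (v := E) (by simp)
    have s1 : w₁.1.support ⊆ {A, B, E} := h₁.trans (by grind)
    have s2 : w₂.1.support ⊆ {C, D, E} := h₂.trans (by grind)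
    have c1 := linearProjection_mem_convexHull s1
    have c2 := linearProjection_mem_convexHull s2
    rw [← heq] at c2
    -- The path runs through the vertex `E`; the common image is a star centre of the two hulls.
    exact (((LiftsIn.of_support_subset hABE s1 (by simp [hE])).mono Set.subset_union_left).trans
      ((LiftsIn.of_support_subset hCDE (w₁ := wE) (by simp [hE]) s2).mono
        Set.subset_union_right)).singleton
      (((convex_convexHull ℝ _).starConvex c1).union ((convex_convexHull ℝ _).starConvex c2))
      (Set.union_subset (convexHull_subset_shadow hABE) (convexHull_subset_shadow hCDE)) heq
      (Or.inl c1)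
  -- The path runs through `A` and a lift of `z` on `EF`. The point `z` lies in all three hulls used
  -- and serves as star centre.
  · rw [← convexHull_pair] at hzE hzA
    have cE : ∀ σ : Finset (EuclideanSpace ℝ (Fin 2)), E ∈ σ → F ∈ σ →
        z ∈ convexHull ℝ (σ : Set (EuclideanSpace ℝ (Fin 2))) := fun σ hE hF =>
      convexHull_mono (by simp [Set.insert_subset_iff, hE, hF]) hzE
    have cA : z ∈ convexHull ℝ (({A, B} : Finset _) : Set (EuclideanSpace ℝ (Fin 2))) := by
      simpa using hzA
    obtain ⟨wA, hA⟩ := exists_vertex_lift hAB (v := A) (by simp)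
    have hEF : {E, F} ∈ K.faces := mem_faces_of_subset hAEF (by grind) (by simp)
    obtain ⟨wz, hwz, -⟩ := K.exists_lift hEF (y := z) (cE _ (by simp) (by simp))
    have d1 := LiftsIn.of_support_subset hAB (w₂ := wA) h₁ (by simp [hA])
    have d2 := LiftsIn.of_support_subset hAEF (w₁ := wA) (w₂ := wz) (by simp [hA])
      (hwz.trans (by grind))
    have d3 := LiftsIn.of_support_subset hCDEF (w₁ := wz) (w₂ := w₂)
      (hwz.trans (by grind)) (h₂.trans (by grind))
    exact (((d1.mono Set.subset_union_left).trans
      (d2.mono Set.subset_union_right)).mono Set.subset_union_left |>.trans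
        (d3.mono Set.subset_union_right)).singleton
      ((((convex_convexHull ℝ _).starConvex cA).union
        ((convex_convexHull ℝ _).starConvex (cE _ (by simp) (by simp)))).union
        ((convex_convexHull ℝ _).starConvex (cE _ (by simp) (by simp))))
      (Set.union_subset (Set.union_subset (convexHull_subset_shadow hAB)
        (convexHull_subset_shadow hAEF)) (convexHull_subset_shadow hCDEF)) heq
      (Or.inl (Or.inl (linearProjection_mem_convexHull h₁)))

variable [ConnectedSpace K.Realization]

/-- Two lifts of a common point of two faces with at most two vertices are joined by a path with
null-homotopic projection. -/
theorem LiftingCondition.liftsIn_of_card_le_two (hlift : K.LiftingCondition)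
    {e f : Finset (EuclideanSpace ℝ (Fin 2))} (he : e ∈ K.faces) (hf : f ∈ K.faces)
    (hec : e.card ≤ 2) (hfc : f.card ≤ 2) {w₁ w₂ : K.Realization}
    (h₁ : w₁.1.support ⊆ e) (h₂ : w₂.1.support ⊆ f)
    (heq : K.linearProjection w₁ = K.linearProjection w₂) :
    K.LiftsIn {K.linearProjection w₁} w₁ w₂ := by
  -- The lifting condition speaks only of edges. A face that cannot be enlarged to an edge is the
  -- only face, which forces `e = f`.
  have same : e = f → K.LiftsIn {K.linearProjection w₁} w₁ w₂ := by
    rintro rfl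
    simpa [← heq] using LiftsIn.segment_of_support_subset he h₁ h₂
  rcases exists_edge_superset_or_eq he hf hec with ⟨e', he', hec', hee'⟩ | h
  swap
  · exact same h.symm
  rcases exists_edge_superset_or_eq hf he hfc with ⟨f', hf', hfc', hff'⟩ | h
  swap
  · exact same h
  have s1 := h₁.trans hee'
  have s2 := h₂.trans hff'
  obtain ⟨A, B, C, D, hor, E, F, -, -, h⟩ := hlift e' he' f' hf' hec' hfc'
    ⟨_, linearProjection_mem_convexHull s1, heq ▸ linearProjection_mem_convexHull s2⟩
  rcases hor with ⟨rfl, rfl⟩ | ⟨rfl, rfl⟩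
  · exact liftsIn_singleton_of_faces he' h s1 s2 heq
  · rw [heq]
    exact (liftsIn_singleton_of_faces hf' h s2 s1 heq.symm).symm

/-- A vertex lying in the hull of a simplex is joined to that simplex by a path whose projection
is homotopic to a path in the hull. -/
theorem LiftingCondition.exists_liftsIn_convexHull (hlift : K.LiftingCondition)
    {σ τ : Finset (EuclideanSpace ℝ (Fin 2))} (hσ : σ ∈ K.faces) (hτ : τ ∈ K.faces)
    {v : EuclideanSpace ℝ (Fin 2)} (hv : v ∈ τ)
    (hvσ : v ∈ convexHull ℝ (σ : Set (EuclideanSpace ℝ (Fin 2))))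
    {w : K.Realization} (hw : w.1.support = {v}) :
    ∃ w' : K.Realization, w'.1.support ⊆ σ ∧
      K.LiftsIn (convexHull ℝ (σ : Set (EuclideanSpace ℝ (Fin 2)))) w w' := by
  have proj : ∀ {u : EuclideanSpace ℝ (Fin 2)} {x : K.Realization}, x.1.support = {u} →
      K.linearProjection x = u := fun {u x} hx => by
    simpa using linearProjection_mem_convexHull (σ := {u}) hx.subset
  obtain ⟨u, hu⟩ := nonempty_of_mem_faces hσ
  -- Follow an edge path towards a vertex of `σ`: an edge between vertices in the hull stays there
  -- by convexity, so only the first exit matters.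
  have hreach := reflTransGen_joins hτ hσ hv hu
  clear hv
  induction hreach using Relation.ReflTransGen.head_induction_on generalizing w with
  | refl =>
    have hwσ : w.1.support ⊆ σ := by simpa [hw] using hu
    exact ⟨w, hwσ, LiftsIn.of_support_subset hσ hwσ hwσ⟩
  | @head v v' h _ ih =>
    obtain ⟨ρ, hρ, hvρ, hv'ρ⟩ := h
    obtain ⟨x, hx⟩ := exists_vertex_lift hρ hv'ρ
    by_cases hv'σ : v' ∈ convexHull ℝ (σ : Set (EuclideanSpace ℝ (Fin 2)))
    · obtain ⟨w', hw', hxw'⟩ := ih hv'σ hx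
      refine ⟨w', hw', LiftsIn.trans (LiftsIn.mono
        (LiftsIn.segment_of_support_subset hρ (by simpa [hw] using hvρ)
          (by simpa [hx] using hv'ρ)) ?_) hxw'⟩
      rw [proj hw, proj hx]
      exact (convex_convexHull ℝ _).segment_subset hvσ hv'σ
    -- The edge exits through a chord `e` of `σ` at `z`; there the path switches from the lift on
    -- the edge to the lift on `e`, and has reached `σ`.
    · classical
      obtain ⟨e, he, hne, hec, z, hze, hz⟩ :=
        exists_card_le_two_inter_segment_nonempty hvσ hv'σ
      have hvv' : {v, v'} ∈ K.faces := mem_faces_of_subset hρ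
        (by simp [Finset.insert_subset_iff, hvρ, hv'ρ]) (by simp)
      have heK := mem_faces_of_subset hσ he hne
      obtain ⟨x₁, hx₁, hx₁z⟩ := K.exists_lift hvv' (y := z) (by simpa [convexHull_pair] using hz)
      obtain ⟨x₂, hx₂, hx₂z⟩ := K.exists_lift heK hze
      have hzσ := convexHull_mono (Finset.coe_subset.2 he) hze
      refine ⟨x₂, hx₂.trans he, LiftsIn.trans (LiftsIn.mono
        (LiftsIn.segment_of_support_subset hvv' (by simp [hw]) hx₁) ?_)
        (LiftsIn.mono (hlift.liftsIn_of_card_le_two hvv' heK Finset.card_le_two hec hx₁ hx₂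
          (hx₁z.trans hx₂z.symm)) ?_)⟩
      · rw [proj hw, hx₁z]
        exact (convex_convexHull ℝ _).segment_subset hvσ hzσ
      · simpa [hx₁z] using hzσ

/-- The path goes from `w₁` to a vertex of `τ`, on to `σ`, then to `w₂`. Up to homotopy its
projection stays in the convex hull of `σ`. -/
theorem LiftingCondition.liftsIn_of_subset (hlift : K.LiftingCondition)
    {σ τ : Finset (EuclideanSpace ℝ (Fin 2))} (hσ : σ ∈ K.faces) (hτ : τ ∈ K.faces)
    (hτσ : (τ : Set (EuclideanSpace ℝ (Fin 2))) ⊆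
      convexHull ℝ (σ : Set (EuclideanSpace ℝ (Fin 2))))
    {w₁ w₂ : K.Realization} (h₁ : w₁.1.support ⊆ τ) (h₂ : w₂.1.support ⊆ σ)
    (heq : K.linearProjection w₁ = K.linearProjection w₂) :
    K.LiftsIn {K.linearProjection w₁} w₁ w₂ := by
  obtain ⟨v, hv⟩ := nonempty_of_mem_faces hτ
  obtain ⟨x, hx⟩ := exists_vertex_lift hτ hv
  obtain ⟨x', hx', hxx'⟩ := hlift.exists_liftsIn_convexHull hσ hτ hv (hτσ hv) hx
  have hconv := convex_convexHull ℝ (σ : Set (EuclideanSpace ℝ (Fin 2)))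
  have hmem := linearProjection_mem_convexHull h₂
  have d1 := (LiftsIn.of_support_subset hτ (w₂ := x) h₁ (by simpa [hx] using hv)).mono
    (convexHull_min hτσ hconv)
  exact ((d1.trans hxx').trans (LiftsIn.of_support_subset hσ hx' h₂)).singleton
    (hconv.starConvex hmem) (convexHull_subset_shadow hσ) heq (heq ▸ hmem)

/-- Any two points of `|K|` with the same projection are joined by a path with null-homotopic
projection. -/
theorem LiftingCondition.liftsIn_singleton (hlift : K.LiftingCondition)
    {w₁ w₂ : K.Realization} (heq : K.linearProjection w₁ = K.linearProjection w₂) :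
    K.LiftsIn {K.linearProjection w₁} w₁ w₂ := by
  have c1 := linearProjection_mem_convexHull (w := w₁) subset_rfl
  have c2 := linearProjection_mem_convexHull (w := w₂) subset_rfl
  rw [← heq] at c2
  rcases convexHull_inter_trichotomy c1 c2 with h | h | h
  · rw [heq]
    exact (hlift.liftsIn_of_subset w₁.2.1 w₂.2.1 h subset_rfl subset_rfl heq.symm).symm
  · exact hlift.liftsIn_of_subset w₂.2.1 w₁.2.1 h subset_rfl subset_rfl heq
  · obtain ⟨e, he, hne, hec, f, hf, hnf, hfc, z, hze, hzf⟩ := h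
    have heK := mem_faces_of_subset w₁.2.1 he hne
    have hfK := mem_faces_of_subset w₂.2.1 hf hnf
    obtain ⟨x₁, hx₁, hx₁z⟩ := K.exists_lift heK hze
    obtain ⟨x₂, hx₂, hx₂z⟩ := K.exists_lift hfK hzf
    have d1 := LiftsIn.of_support_subset w₁.2.1 subset_rfl (hx₁.trans he)
    have d2 := hlift.liftsIn_of_card_le_two heK hfK hec hfc hx₁ hx₂ (hx₁z.trans hx₂z.symm)
    have d3 := LiftsIn.of_support_subset w₂.2.1 (hx₂.trans hf) subset_rfl
    -- The switch takes place over the crossing point `z`, but the star centre is the common image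
    -- of `w₁` and `w₂`.
    refine (((d1.mono Set.subset_union_left).trans (d2.mono ?_)).trans
      (d3.mono Set.subset_union_right)).singleton
      (((convex_convexHull ℝ _).starConvex c1).union ((convex_convexHull ℝ _).starConvex c2))
      (Set.union_subset (convexHull_subset_shadow w₁.2.1) (convexHull_subset_shadow w₂.2.1)) heq
      (Or.inl c1)
    rw [hx₁z]
    exact Set.singleton_subset_iff.2 (Or.inl (convexHull_mono (Finset.coe_subset.2 he) hze))

end PreAbstractSimplicialComplex

/-! ### Lifting paths of a locally finite shadow -/

namespace PreAbstractSimplicialComplex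

variable {N : ℕ} {K : PreAbstractSimplicialComplex (EuclideanSpace ℝ (Fin N))}

theorem exists_lift_of_mem_shadow (a : K.shadow) : ∃ w, K.shadowProjection w = a := by
  obtain ⟨σ, hσ, ha⟩ := Set.mem_iUnion₂.1 a.2
  obtain ⟨w, -, hw⟩ := K.exists_lift hσ ha
  exact ⟨w, Subtype.ext hw⟩

/-- Locally, every simplex of a locally finite shadow contains the centre of the neighbourhood. -/
theorem ShadowLocallyFinite.exists_ball (hfin : K.ShadowLocallyFinite) (y : K.shadow) :
    ∃ r > 0, ∀ σ ∈ K.faces,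
      (convexHull ℝ (σ : Set (EuclideanSpace ℝ (Fin N))) ∩ Metric.ball (y : _) r).Nonempty →
      (y : EuclideanSpace ℝ (Fin N)) ∈ convexHull ℝ (σ : Set (EuclideanSpace ℝ (Fin N))) := by
  obtain ⟨U, hU, hF⟩ := hfin y y.2
  set F := {σ ∈ K.faces | (convexHull ℝ (σ : Set (EuclideanSpace ℝ (Fin N))) ∩ U).Nonempty}
  -- Only finitely many hulls near `y` miss `y`, and they are closed, so a smaller ball avoids them
  -- all.
  have hG : (F ∩ {σ | (y : EuclideanSpace ℝ (Fin N)) ∉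
      convexHull ℝ (σ : Set (EuclideanSpace ℝ (Fin N)))}).Finite := hF.inter_of_left _
  have hV : (⋂ σ ∈ F ∩ {σ | (y : EuclideanSpace ℝ (Fin N)) ∉
      convexHull ℝ (σ : Set (EuclideanSpace ℝ (Fin N)))},
      (convexHull ℝ (σ : Set (EuclideanSpace ℝ (Fin N))))ᶜ) ∈ 𝓝 (y : EuclideanSpace ℝ (Fin N)) :=
    (Filter.biInter_mem hG).2 fun σ hσ =>
      (σ.finite_toSet.isClosed_convexHull ℝ).isOpen_compl.mem_nhds hσ.2
  obtain ⟨r, hr, hball⟩ := Metric.mem_nhds_iff.1 (Filter.inter_mem hU hV)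
  refine ⟨r, hr, fun σ hσ ⟨x, hx, hxr⟩ => by_contra fun hy => ?_⟩
  exact Set.mem_iInter₂.1 (hball hxr).2 σ ⟨⟨hσ, x, hx, (hball hxr).1⟩, hy⟩ hx

/-- For all lifts of its endpoints, the path `q` is homotopic to the projection of a path joining
these lifts. -/
def PathLiftable {a b : K.shadow} (q : Path a b) : Prop :=
  ∀ (w₁ w₂ : K.Realization) (h₁ : K.shadowProjection w₁ = a) (h₂ : K.shadowProjection w₂ = b),
    ∃ δ : Path w₁ w₂, ((δ.map K.shadowProjection.continuous).cast h₁.symm h₂.symm).Homotopic q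

/-- Quantifying over all lifts of the endpoints makes any lift of `b` a valid joint. -/
theorem PathLiftable.trans {a b c : K.shadow} {q : Path a b} {q' : Path b c}
    (h : PathLiftable q) (h' : PathLiftable q') : PathLiftable (q.trans q') := by
  rintro w₁ w₃ rfl rfl
  obtain ⟨w₂, rfl⟩ := exists_lift_of_mem_shadow b
  obtain ⟨δ, hδ⟩ := h w₁ w₂ rfl rfl
  obtain ⟨δ', hδ'⟩ := h' w₂ w₃ rfl rfl
  refine ⟨δ.trans δ', ?_⟩
  rw [Path.map_trans]
  exact hδ.hcomp hδ'

theorem PathLiftable.of_homotopic {a b : K.shadow} {q q' : Path a b}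
    (h : PathLiftable q) (hq : q.Homotopic q') : PathLiftable q' := by
  rintro w₁ w₂ h₁ h₂
  obtain ⟨δ, hδ⟩ := h w₁ w₂ h₁ h₂
  exact ⟨δ, hδ.trans hq⟩

/-- Paths in a part of the shadow whose points share a simplex with a given point are liftable. -/
theorem pathLiftable_of_starConvex
    (hfib : ∀ w₁ w₂ : K.Realization,
      K.linearProjection w₁ = K.linearProjection w₂ →
      K.LiftsIn {K.linearProjection w₁} w₁ w₂)
    {c : EuclideanSpace ℝ (Fin N)}
    {S : Set (EuclideanSpace ℝ (Fin N))} (hS : StarConvex ℝ c S) (hSK : S ⊆ K.shadow)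
    (hc : ∀ z ∈ S, ∃ σ ∈ K.faces, z ∈ convexHull ℝ (σ : Set (EuclideanSpace ℝ (Fin N))) ∧
      c ∈ convexHull ℝ (σ : Set (EuclideanSpace ℝ (Fin N))))
    {a b : K.shadow} (q : Path a b) (hq : ∀ t, (q t : EuclideanSpace ℝ (Fin N)) ∈ S) :
    PathLiftable q := by
  rintro w₁ w₂ rfl rfl
  have h₁ : K.linearProjection w₁ ∈ S := by
    have := hq 0
    rwa [q.source] at this
  have h₂ : K.linearProjection w₂ ∈ S := by
    have := hq 1
    rwa [q.target] at this
  -- Switch to a lift in a simplex shared with `c`, then follow it to a lift of `c`. The lifts of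
  -- `c` reached from the two ends are joined within the fibre.
  have toCentre : ∀ w : K.Realization, K.linearProjection w ∈ S →
      ∃ x, K.linearProjection x = c ∧ K.LiftsIn S w x := by
    intro w hw
    obtain ⟨σ, hσ, hwσ, hcσ⟩ := hc _ hw
    obtain ⟨u, hu, huw⟩ := K.exists_lift hσ hwσ
    obtain ⟨x, hx, hxc⟩ := K.exists_lift hσ hcσ
    refine ⟨x, hxc, ((hfib w u huw.symm).mono (Set.singleton_subset_iff.2 hw)).trans
      ((LiftsIn.segment_of_support_subset hσ hu hx).mono ?_)⟩
    rw [huw, hxc, segment_symm]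
    exact hS.segment_subset hw
  obtain ⟨x₁, hx₁, d₁⟩ := toCentre w₁ h₁
  obtain ⟨x₂, hx₂, d₂⟩ := toCentre w₂ h₂
  have hcS : c ∈ S := hS.mem ⟨_, h₁⟩
  have d := (d₁.trans ((hfib x₁ x₂ (hx₁.trans hx₂.symm)).mono
    (by simpa [hx₁] using hcS))).trans d₂.symm
  obtain ⟨δ, ε, hε, h⟩ := d
  exact ⟨δ, h.trans (hS.path_homotopic hSK ε q hε hq)⟩

theorem ShadowLocallyFinite.pathLiftable (hfin : K.ShadowLocallyFinite)
    (hfib : ∀ w₁ w₂ : K.Realization,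
      K.linearProjection w₁ = K.linearProjection w₂ →
      K.LiftsIn {K.linearProjection w₁} w₁ w₂)
    {a b : K.shadow}
    (q : Path a b) : PathLiftable q := by
  choose r hr hball using hfin.exists_ball
  have hloc : ∀ (y : K.shadow) {a b : K.shadow} (q : Path a b),
      (∀ t, (q t : EuclideanSpace ℝ (Fin N)) ∈ Metric.ball (y : EuclideanSpace ℝ (Fin N)) (r y)) →
      PathLiftable q := by
    intro y a b q hq
    have share : ∀ z ∈ K.shadow ∩ Metric.ball (y : EuclideanSpace ℝ (Fin N)) (r y),
        ∃ σ ∈ K.faces, z ∈ convexHull ℝ (σ : Set (EuclideanSpace ℝ (Fin N))) ∧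
          (y : EuclideanSpace ℝ (Fin N)) ∈
            convexHull ℝ (σ : Set (EuclideanSpace ℝ (Fin N))) := by
      rintro z ⟨hz, hzr⟩
      obtain ⟨σ, hσ, hzσ⟩ := Set.mem_iUnion₂.1 hz
      exact ⟨σ, hσ, hzσ, hball y σ hσ ⟨z, hzσ, hzr⟩⟩
    refine pathLiftable_of_starConvex hfib (c := y) (starConvex_iff_segment_subset.2 ?_)
      Set.inter_subset_left share q fun t => ⟨(q t).2, hq t⟩
    intro z hz
    obtain ⟨σ, hσ, hzσ, hyσ⟩ := share z hz
    exact Set.subset_inter (((convex_convexHull ℝ _).segment_subset hyσ hzσ).trans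
      (convexHull_subset_shadow hσ))
      ((convex_ball _ _).segment_subset (Metric.mem_ball_self (hr y)) hz.2)
  -- Lebesgue subdivision: each piece of `q` stays in one of the balls, and `t` equals `1` from `n`
  -- on.
  obtain ⟨t, ht0, hmono, ⟨n, hn⟩, ht⟩ := exists_monotone_Icc_subset_open_cover_unitInterval
    (c := fun y : K.shadow => {s | (q s : EuclideanSpace ℝ (Fin N)) ∈
      Metric.ball (y : EuclideanSpace ℝ (Fin N)) (r y)})
    (fun y => Metric.isOpen_ball.preimage (continuous_subtype_val.comp q.continuous))
    (fun s _ => Set.mem_iUnion.2 ⟨q s, Metric.mem_ball_self (hr (q s))⟩)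
  have hsub : ∀ m, PathLiftable (q.subpath (t 0) (t m)) := by
    intro m
    induction m with
    | zero =>
      refine hloc (q (t 0)) _ fun s => ?_
      rw [Path.subpath_self]
      exact Metric.mem_ball_self (hr _)
    | succ m ih =>
      obtain ⟨y, hy⟩ := ht m
      refine (ih.trans (hloc y (q.subpath (t m) (t (m + 1))) fun s => ?_)).of_homotopic
        ⟨Path.Homotopy.subpathTransSubpath q _ _ _⟩
      have hs : q.subpath (t m) (t (m + 1)) s ∈ q '' Set.Icc (t m) (t (m + 1)) := by
        rw [← q.range_subpath_of_le _ _ (hmono m.le_succ)]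
        exact ⟨s, rfl⟩
      obtain ⟨s', hs', heq⟩ := hs
      rw [← heq]
      exact hy hs'
  have h1 := hsub n
  rw [ht0, hn n le_rfl, Path.subpath_zero_one] at h1
  intro w₁ w₂ h₁ h₂
  exact h1 w₁ w₂ (h₁.trans q.source.symm) (h₂.trans q.target.symm)

/-- Choosing `x` as the lift of both endpoints makes the lifted path a loop. -/
theorem ShadowLocallyFinite.surjective_fundamentalGroup_map (hfin : K.ShadowLocallyFinite)
    (hfib : ∀ w₁ w₂ : K.Realization,
      K.linearProjection w₁ = K.linearProjection w₂ →
      K.LiftsIn {K.linearProjection w₁} w₁ w₂)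
    (x : K.Realization) : Function.Surjective (FundamentalGroup.map K.shadowProjection x) := by
  intro g
  obtain ⟨q, rfl⟩ := Path.Homotopic.Quotient.mk_surjective g
  obtain ⟨δ, hδ⟩ := hfin.pathLiftable hfib q x x rfl rfl
  exact ⟨FundamentalGroup.fromPath (Path.Homotopic.Quotient.mk δ),
    Path.Homotopic.Quotient.eq.2 hδ⟩

end PreAbstractSimplicialComplex

theorem mainTheorem3 (K : PreAbstractSimplicialComplex (EuclideanSpace ℝ (Fin 2)))
    (hfin : K.ShadowLocallyFinite) (hconn : ConnectedSpace K.Realization)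
    (hlift : K.LiftingCondition) (x : K.Realization) :
    Function.Surjective (FundamentalGroup.map K.shadowProjection x) := by
  exact hfin.surjective_fundamentalGroup_map (fun _ _ h => hlift.liftsIn_singleton h) x
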